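/- An infinite subgroup $H$ of a group $G$ has \emph{infinite height} when for every $n$ there are $g_1,\dots,g_n\in G$ with $Hg_i\neq Hg_j$ for $i\neq j$ and $\bigcap_{i=1}^n g_i^{-1}Hg_i$ infinite. \textbf{The groups.} Let $p>q>0$ be integers. Let $G_1$ be the group with generators $a_1,a_2,b_0,\dots,b_p,t,x_1,x_2,y_1,y_2$ and the $5p+11$ defining relations $$b_i^{-1}(a_1b_{i+1})\,b_i=a_1\epsilon_i\,Z t^{-1}Z t Z,\qquad b_i^{-1}a_2b_i=a_2\,Zt^{-1}ZtZ,\qquad b_i^{-1}tb_i=ZtZ,\qquad b_i^{-1}x_jb_i=Zt^{-1}ZtZ,$$ $$a_l^{-1}ta_l=YtY,\qquad a_l^{-1}y_ja_l=Yt^{-1}YtY\qquad(0\le i\le p,\ j,l\in\{1,2\}),$$ where $b_{p+1}$ is read as $1$, $\epsilon_{q-1}=a_2$ and $\epsilon_i=1$ for $i\ne q-1$. Each occurrence of $Z$ or $Y$ stands for its own word, chosen independently: a word in $x_1^{\pm1},x_2^{\pm1}$ for a $Z$ with $i\geq 1$, and a word in $y_1^{\pm1},y_2^{\pm1}$ for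 a $Z$ with $i=0$ and for every $Y$. These words may be arbitrary; in particular they may be the small-cancellation (Rips) words for which $G_1$ is hyperbolic and $\langle t,y_1,y_2\rangle$ is free of rank $3$ with distortion $\simeq\exp(n^{p/q})$. Put $m_1=3$ and $F_{m_1}=\langle t,y_1,y_2\rangle\le G_1$. Let $m_1<m_2<\cdots$ be integers and, for $k\ge1$, let $$G_{k+1}=(F_{m_{k+1}}\rtimes F_{m_k})\ast_{F_{m_k}}G_k,$$ where $F_{m_{k+1}}$ is a free group of rank $m_{k+1}$ on which the subgroup $F_{m_k}\le G_k$ acts by any automorphisms; in $G_{k+1}$ the distinguished subgroup is the normal factor $F_{m_{k+1}}$ of the semidirect product. (If the semidirect products are hyperbolic and the words are the Rips words, then $F_{m_k}\le G_k$ is the free subgroup of a hyperbolic group with distortion $\simeq\exp^k(n^{p/q})$.) \textbf{Proposition.} For every $k\geq1$: \begin{enumerate} \item $F_{m_k}$ has infinite height in $G_k$. \item If $H$ is any group and $F_{m_k}\hookrightarrow H$ is any embedding, then $H$ has infinite height in $H\ast_{F_{m_k}}G_k$. (In particular this holds when $H$ is a non-elementary torsion-free hyperbolic group in which the image of $F_{m_k}$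 is malnormal and quasiconvex, which is the construction that realizes the distortion $\exp^k(n^{p/q})$, $p>q$, for $H$.) \item Let $F$ be the image of $\langle t,y_1,y_2\rangle$ in $G_k$. Then $F$ has infinite height in $G_k$; the subgroups $a_1^{-i}Fa_1^{i}$, $i\geq0$, are infinite and satisfy $a_1^{-(i+1)}Fa_1^{i+1}\subseteq a_1^{-i}Fa_1^{i}$; and the cosets $Fa_1^i$, $i\ge0$, are pairwise distinct. \end{enumerate} -/

import Mathlib

open scoped Pointwise

/-- The conjugate subgroup `g⁻¹ H g`. -/
def conjBy {G : Type*} [Group G] (H : Subgroup G) (g : G) : Subgroup G :=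
  H.map (MulAut.conj g⁻¹).toMonoidHom

/-- The right coset `H g`, as a subset of the group. -/
def rightCosetOf {G : Type*} [Group G] (H : Subgroup G) (g : G) : Set G :=
  (fun h : G => h * g) '' (H : Set G)

/-- `H` has infinite height in `G`: it is infinite and for every `n` there are `n` elements `g i`
whose right cosets `H (g i)` are pairwise distinct and such that the intersection of the
conjugates `(g i)⁻¹ H (g i)` is infinite. -/
def HasInfiniteHeight {G : Type*} [Group G] (H : Subgroup G) : Prop :=
  Infinite H ∧ ∀ n : ℕ, ∃ g : Fin n → G,
    Infinite (⨅ i, conjBy H (g i) : Subgroup G) ∧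
    ∀ i j, i ≠ j → rightCosetOf H (g i) ≠ rightCosetOf H (g j)

section Amalgam

/-- The two-member family with values `A` and `B`. -/
def AmalgamFamily (A B : Type) : Bool → Type
  | true => A
  | false => B

instance AmalgamFamily.instGroup (A B : Type) [Group A] [Group B] :
    ∀ s, Group (AmalgamFamily A B s)
  | true => inferInstanceAs (Group A)
  | false => inferInstanceAs (Group B)

/-- The two homomorphisms that are amalgamated, as a family. -/
def amalgamMaps {A B C : Type} [Group A] [Group B] [Group C] (f : C →* A) (g : C →* B) :
    ∀ s, C →* AmalgamFamily A B s
  | true => f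
  | false => g

/-- The amalgamated product `A *_C B` along `f : C → A` and `g : C → B`. -/
abbrev Amalgam {A B C : Type} [Group A] [Group B] [Group C] (f : C →* A) (g : C →* B) : Type :=
  Monoid.PushoutI (amalgamMaps f g)

/-- The canonical map `A → A *_C B`. -/
def Amalgam.left {A B C : Type} [Group A] [Group B] [Group C] (f : C →* A) (g : C →* B) :
    A →* Amalgam f g :=
  Monoid.PushoutI.of (φ := amalgamMaps f g) true

/-- The canonical map `B → A *_C B`. -/
def Amalgam.right {A B C : Type} [Group A] [Group B] [Group C] (f : C →* A) (g : C →* B) :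
    B →* Amalgam f g :=
  Monoid.PushoutI.of (φ := amalgamMaps f g) false

end Amalgam

/-! ### The group `G` given by generators and relators -/

/-- The generators: `a 0, a 1` stand for `a₁, a₂`, then `b₀, …, b_p` and `t`, and `x 0, x 1`,
`y 0, y 1` stand for `x₁, x₂`, `y₁, y₂`. -/
inductive Gen (p : ℕ) : Type
  | a (i : Fin 2) : Gen p
  | b (i : Fin (p + 1)) : Gen p
  | t : Gen p
  | x (j : Fin 2) : Gen p
  | y (j : Fin 2) : Gen p

/-- The noise words, each given as a word in two letters, one for each place of the defining
relators in which a noise word occurs. The `14 p` words with first index `i ≠ 0` among `n1, …, n3'`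
will be read in `x₁, x₂`; the `14` words with `i = 0`, and the `16` words of `n4, n4'`, will be
read in `y₁, y₂`. -/
structure NoiseWords (p : ℕ) : Type where
  n1 : Fin (p + 1) → Fin 3 → FreeGroup (Fin 2)
  n2 : Fin (p + 1) → Fin 3 → FreeGroup (Fin 2)
  n3 : Fin (p + 1) → Fin 2 → FreeGroup (Fin 2)
  n3' : Fin (p + 1) → Fin 2 → Fin 3 → FreeGroup (Fin 2)
  n4 : Fin 2 → Fin 2 → FreeGroup (Fin 2)
  n4' : Fin 2 → Fin 2 → Fin 3 → FreeGroup (Fin 2)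

section Relators

variable {p : ℕ}

/-- The pair of letters used by the noise in the relators of `b_i`: `y` for `i = 0`, otherwise
`x`. -/
def bLetter (i : Fin (p + 1)) : Fin 2 → Gen p :=
  if i = 0 then Gen.y else Gen.x

/-- The noise `Z₀ t Z₁`, where the words `Z` are read in the letters `z`. -/
def shortNoise (z : Fin 2 → Gen p) (Z : Fin 2 → FreeGroup (Fin 2)) : FreeGroup (Gen p) :=
  FreeGroup.map z (Z 0) * FreeGroup.of Gen.t * FreeGroup.map z (Z 1)

/-- The noise `Z₀ t⁻¹ Z₁ t Z₂`, where the words `Z` are read in the letters `z`. -/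
def longNoise (z : Fin 2 → Gen p) (Z : Fin 3 → FreeGroup (Fin 2)) : FreeGroup (Gen p) :=
  FreeGroup.map z (Z 0) * (FreeGroup.of Gen.t)⁻¹ * FreeGroup.map z (Z 1) * FreeGroup.of Gen.t *
    FreeGroup.map z (Z 2)

/-- The letter `b_{i+1}` if `i < p`, and the empty word if `i = p`. -/
def bNext (i : Fin (p + 1)) : FreeGroup (Gen p) :=
  if h : (i : ℕ) + 1 < p + 1 then FreeGroup.of (Gen.b ⟨i + 1, h⟩) else 1

/-- The relator of `u⁻¹ s u = v`. -/
def conjRelator (u s v : FreeGroup (Gen p)) : FreeGroup (Gen p) := u⁻¹ * s * u * v⁻¹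

/-- `b_i⁻¹ (a₁ b_{i+1}) b_i = a₁ Z t⁻¹ Z t Z`, with `a₁ a₂` in place of the second `a₁` for
`i = q - 1`, and without `b_{i+1}` for `i = p`. -/
def rel1 (q : ℕ) (W : NoiseWords p) (i : Fin (p + 1)) : FreeGroup (Gen p) :=
  conjRelator (FreeGroup.of (Gen.b i)) (FreeGroup.of (Gen.a 0) * bNext i)
    (FreeGroup.of (Gen.a 0) * (if (i : ℕ) + 1 = q then FreeGroup.of (Gen.a 1) else 1) *
      longNoise (bLetter i) (W.n1 i))

/-- `b_i⁻¹ a₂ b_i = a₂ Z t⁻¹ Z t Z`. -/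
def rel2 (W : NoiseWords p) (i : Fin (p + 1)) : FreeGroup (Gen p) :=
  conjRelator (FreeGroup.of (Gen.b i)) (FreeGroup.of (Gen.a 1))
    (FreeGroup.of (Gen.a 1) * longNoise (bLetter i) (W.n2 i))

/-- `b_i⁻¹ t b_i = Z t Z`. -/
def rel3 (W : NoiseWords p) (i : Fin (p + 1)) : FreeGroup (Gen p) :=
  conjRelator (FreeGroup.of (Gen.b i)) (FreeGroup.of Gen.t) (shortNoise (bLetter i) (W.n3 i))

/-- `b_i⁻¹ x_j b_i = Z t⁻¹ Z t Z`. -/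
def rel3' (W : NoiseWords p) (i : Fin (p + 1)) (j : Fin 2) : FreeGroup (Gen p) :=
  conjRelator (FreeGroup.of (Gen.b i)) (FreeGroup.of (Gen.x j))
    (longNoise (bLetter i) (W.n3' i j))

/-- `a_i⁻¹ t a_i = Y t Y`. -/
def rel4 (W : NoiseWords p) (i : Fin 2) : FreeGroup (Gen p) :=
  conjRelator (FreeGroup.of (Gen.a i)) (FreeGroup.of Gen.t) (shortNoise Gen.y (W.n4 i))

/-- `a_i⁻¹ y_j a_i = Y t⁻¹ Y t Y`. -/
def rel4' (W : NoiseWords p) (i j : Fin 2) : FreeGroup (Gen p) :=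
  conjRelator (FreeGroup.of (Gen.a i)) (FreeGroup.of (Gen.y j)) (longNoise Gen.y (W.n4' i j))

/-- The `5 p + 11` defining relators. -/
def relators (q : ℕ) (W : NoiseWords p) : Set (FreeGroup (Gen p)) :=
  Set.range (rel1 q W) ∪ Set.range (rel2 W) ∪ Set.range (rel3 W) ∪
    Set.range (fun s : Fin (p + 1) × Fin 2 => rel3' W s.1 s.2) ∪
    Set.range (rel4 W) ∪ Set.range (fun s : Fin 2 × Fin 2 => rel4' W s.1 s.2)

/-- The group `G` with generators `a₁, a₂, b₀, …, b_p, t, x₁, x₂, y₁, y₂` and the above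
relators. -/
abbrev NoiseGroup (q : ℕ) (W : NoiseWords p) : Type := PresentedGroup (relators q W)

/-- The element of `G` represented by a generator. -/
def gen (q : ℕ) (W : NoiseWords p) (s : Gen p) : NoiseGroup q W := PresentedGroup.of s

/-- The subgroup `⟨t, y₁, y₂⟩` of `G`. -/
def noiseSubgroup (q : ℕ) (W : NoiseWords p) : Subgroup (NoiseGroup q W) :=
  Subgroup.closure {gen q W Gen.t, gen q W (Gen.y 0), gen q W (Gen.y 1)}

end Relators

/-! ### The iterated amalgams `G_k` -/

/-- A group with a distinguished subgroup `F` and a homomorphism from a fixed group `Γ`. -/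
structure PairOver (Γ : Type) [Group Γ] : Type 1 where
  carrier : Type
  [group : Group carrier]
  ofBase : Γ →* carrier
  F : Subgroup carrier

attribute [instance] PairOver.group

/-- The group `Γ` itself, with the subgroup `F`. -/
def PairOver.base {Γ : Type} [Group Γ] (F : Subgroup Γ) : PairOver Γ where
  carrier := Γ
  ofBase := MonoidHom.id Γ
  F := F

/-- From `F ≤ K` and an action of `F` on the free group `F_m` of rank `m`, form the amalgam
`(F_m ⋊ F) *_F K` with its subgroup `F_m`. -/
def PairOver.extend {Γ : Type} [Group Γ] (P : PairOver Γ) (m : ℕ)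
    (φ : P.F →* MulAut (FreeGroup (Fin m))) : PairOver Γ where
  carrier := Amalgam (SemidirectProduct.inr : P.F →* FreeGroup (Fin m) ⋊[φ] P.F) P.F.subtype
  ofBase := (Amalgam.right _ _).comp P.ofBase
  F := ((Amalgam.left _ _).comp SemidirectProduct.inl).range

/-- `IsIterate P m₁ k m Q` says that `Q` is a possible `k`-th pair `F_{m_k} ≤ G_k` of the
construction, with `m_k = m`, where `F_{m_1} ≤ G_1` is `P` and
`G_{i+1} = (F_{m_{i+1}} ⋊ F_{m_i}) *_{F_{m_i}} G_i` for some numbers `m₁ < m₂ < ⋯` and some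
actions of `F_{m_i}` on the free group `F_{m_{i+1}}`. -/
inductive IsIterate {Γ : Type} [Group Γ] (P : PairOver Γ) (m₁ : ℕ) :
    ℕ → ℕ → PairOver Γ → Prop
  | base : IsIterate P m₁ 1 m₁ P
  | step {k m : ℕ} {Q : PairOver Γ} (hQ : IsIterate P m₁ k m Q) (m' : ℕ) (hm : m < m')
      (φ : Q.F →* MulAut (FreeGroup (Fin m'))) : IsIterate P m₁ (k + 1) m' (Q.extend m' φ)

/-! ### Criteria for infinite height -/

section InfiniteHeight

variable {G G' : Type*} [Group G] [Group G']

/-! Two mechanisms produce infinite height. In `G_1`, the relators of `a₁` put the conjugate of `F =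
⟨t, y₁, y₂⟩` by `a₁` inside `F`, so the conjugates by powers of `a₁` form a descending chain of
infinite groups. Exponent counts in `t` and `a₁` show that `F` is infinite and that the cosets are
distinct, whatever the noise words (`hasInfiniteHeight_noiseSubgroup`). For `k ≥ 2`, `F_{m_k}` is
normal in a semidirect product with an infinite group, so all its conjugates by elements of that
group coincide (`hasInfiniteHeight_range_inl`).

Both survive in the amalgams because the factors embed. In `H *_F G_k` the factor `H` meets `G_k`
exactly in `F`, so the elements that work for `F` work for `H` (`HasInfiniteHeight.of_comap`). -/

theorem mem_conjBy {H : Subgroup G} {g x : G} : x ∈ conjBy H g ↔ g * x * g⁻¹ ∈ H := by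
  unfold conjBy
  rw [Subgroup.mem_map]
  constructor
  · rintro ⟨y, hy, rfl⟩
    simpa [mul_assoc] using hy
  · intro h
    exact ⟨_, h, by simp [mul_assoc]⟩

theorem rightCosetOf_eq_iff {H : Subgroup G} {a b : G} :
    rightCosetOf H a = rightCosetOf H b ↔ a * b⁻¹ ∈ H := by
  constructor
  · intro h
    have ha : a ∈ rightCosetOf H a := ⟨1, H.one_mem, one_mul a⟩
    rw [h] at ha
    obtain ⟨y, hy, rfl⟩ := ha
    simpa using hy
  · intro h
    ext x
    constructor
    · rintro ⟨y, hy, rfl⟩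
      exact ⟨y * (a * b⁻¹), H.mul_mem hy h, by simp [mul_assoc]⟩
    · rintro ⟨y, hy, rfl⟩
      exact ⟨y * (a * b⁻¹)⁻¹, H.mul_mem hy (H.inv_mem h), by simp [mul_assoc]⟩

theorem infinite_conjBy {H : Subgroup G} (hH : Infinite H) (g : G) : Infinite (conjBy H g) :=
  (H.equivMapOfInjective (MulAut.conj g⁻¹).toMonoidHom
    (MulAut.conj g⁻¹).injective).toEquiv.infinite_iff.1 hH

theorem infinite_subgroup_of_injective (f : G →* G') (hf : Function.Injective f)
    {K : Subgroup G} {H : Subgroup G'} (hK : Infinite K) (h : ∀ x ∈ K, f x ∈ H) : Infinite H :=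
  Infinite.of_injective (fun x : K => (⟨f x, h x x.2⟩ : H)) fun _ _ hxy =>
    Subtype.ext (hf (congrArg Subtype.val hxy))

/-- Infinite height passes along an embedding `f` to any subgroup whose preimage is the given
one. -/
theorem HasInfiniteHeight.of_comap {K : Subgroup G} (hK : HasInfiniteHeight K) (f : G →* G')
    (hf : Function.Injective f) {H : Subgroup G'} (h : ∀ x, f x ∈ H ↔ x ∈ K) :
    HasInfiniteHeight H := by
  refine ⟨infinite_subgroup_of_injective f hf hK.1 fun x => (h x).2, fun n => ?_⟩
  obtain ⟨g, hg, hne⟩ := hK.2 n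
  refine ⟨fun i => f (g i), infinite_subgroup_of_injective f hf hg fun x hx => ?_,
    fun i j hij heq => hne i j hij ?_⟩
  · simp only [Subgroup.mem_iInf, mem_conjBy] at hx ⊢
    exact fun i => by simpa using (h _).2 (hx i)
  · rw [rightCosetOf_eq_iff] at heq ⊢
    exact (h _).1 (by simpa using heq)

theorem HasInfiniteHeight.map {K : Subgroup G} (hK : HasInfiniteHeight K) (f : G →* G')
    (hf : Function.Injective f) : HasInfiniteHeight (K.map f) :=
  hK.of_comap f hf fun _ => Subgroup.mem_map_iff_mem hf

/-- An infinite subgroup whose conjugates by the powers of `a` decrease, and whose cosets by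
them are distinct, has infinite height. -/
theorem hasInfiniteHeight_of_antitone {H : Subgroup G} (hH : Infinite H) (a : G)
    (hanti : Antitone fun i : ℕ => conjBy H (a ^ i))
    (hinj : Function.Injective fun i : ℕ => rightCosetOf H (a ^ i)) : HasInfiniteHeight H := by
  refine ⟨hH, fun n => ⟨fun i => a ^ (i : ℕ), ?_, fun i j hij h => hij (Fin.ext (hinj h))⟩⟩
  -- The `n`-th conjugate lies in all the earlier ones; the exponent `n` rather than `n - 1` also
  -- covers `n = 0`.
  have hle : conjBy H (a ^ n) ≤ ⨅ i : Fin n, conjBy H (a ^ (i : ℕ)) :=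
    le_iInf fun i => hanti i.2.le
  exact infinite_subgroup_of_injective (MonoidHom.id G) Function.injective_id
    (infinite_conjBy hH (a ^ n)) fun x hx => hle hx

theorem antitone_conjBy_pow {H : Subgroup G} {a : G} (h : conjBy H a ≤ H) :
    Antitone fun i : ℕ => conjBy H (a ^ i) := by
  refine antitone_nat_of_succ_le fun i x hx => ?_
  rw [mem_conjBy] at hx ⊢
  refine h (mem_conjBy.2 ?_)
  -- Writing `a ^ (i + 1)` as `a * a ^ i` reduces the inclusion to `h`, applied to the conjugate of
  -- `x` by `a ^ i`.
  simpa [pow_succ', mul_assoc] using hx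

theorem conjBy_map (H : Subgroup G) (f : G →* G') (g : G) :
    conjBy (H.map f) (f g) = (conjBy H g).map f := by
  unfold conjBy
  rw [Subgroup.map_map, Subgroup.map_map]
  congr 1
  ext x
  simp

/-- The normal factor of a semidirect product of infinite groups has infinite height. -/
theorem hasInfiniteHeight_range_inl {N K : Type*} [Group N] [Group K] [Infinite N] [Infinite K]
    (φ : K →* MulAut N) :
    HasInfiniteHeight (SemidirectProduct.inl : N →* N ⋊[φ] K).range := by
  have hinf : Infinite (SemidirectProduct.inl : N →* N ⋊[φ] K).range :=
    (MonoidHom.ofInjective SemidirectProduct.inl_injective).toEquiv.infinite_iff.1 ‹_›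
  refine ⟨hinf, fun n => ⟨fun i => SemidirectProduct.inr (Infinite.natEmbedding K i), ?_, ?_⟩⟩
  · refine infinite_subgroup_of_injective (MonoidHom.id _) Function.injective_id hinf ?_
    intro x hx
    simp only [Subgroup.mem_iInf, mem_conjBy, SemidirectProduct.range_inl_eq_ker_rightHom,
      MonoidHom.mem_ker, MonoidHom.id_apply] at hx ⊢
    simp [show x.right = 1 from hx]
  · intro i j hij h
    rw [rightCosetOf_eq_iff, SemidirectProduct.range_inl_eq_ker_rightHom, MonoidHom.mem_ker] at h
    simp only [map_mul, map_inv, SemidirectProduct.rightHom_inr, mul_inv_eq_one] at h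
    exact hij (Fin.ext ((Infinite.natEmbedding K).injective h))

end InfiniteHeight

/-! ### Factors of an amalgam and their intersection -/

section AmalgamEmbedding

variable {A B C : Type} [Group A] [Group B] [Group C] {f : C →* A} {g : C →* B}

theorem amalgamMaps_injective (hf : Function.Injective f) (hg : Function.Injective g) :
    ∀ s, Function.Injective (amalgamMaps f g s)
  | true => hf
  | false => hg

theorem Amalgam.left_injective (hf : Function.Injective f) (hg : Function.Injective g) :
    Function.Injective (Amalgam.left f g) :=
  Monoid.PushoutI.of_injective (amalgamMaps_injective hf hg) true

theorem Amalgam.right_injective (hf : Function.Injective f) (hg : Function.Injective g) :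
    Function.Injective (Amalgam.right f g) :=
  Monoid.PushoutI.of_injective (amalgamMaps_injective hf hg) false

theorem Amalgam.left_eq_right (c : C) : Amalgam.left f g (f c) = Amalgam.right f g (g c) :=
  (Monoid.PushoutI.of_apply_eq_base (amalgamMaps f g) true c).trans
    (Monoid.PushoutI.of_apply_eq_base (amalgamMaps f g) false c).symm

theorem Amalgam.right_mem_range_left (hf : Function.Injective f) (hg : Function.Injective g)
    (x : B) : Amalgam.right f g x ∈ (Amalgam.left f g).range ↔ x ∈ g.range := by
  constructor
  · intro h
    have hmem : Amalgam.right f g x ∈ (Monoid.PushoutI.base (amalgamMaps f g)).range := by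
      rw [← Monoid.PushoutI.inf_of_range_eq_base_range (amalgamMaps_injective hf hg)
        (i := true) (j := false) (by decide)]
      exact ⟨h, x, rfl⟩
    obtain ⟨c, hc⟩ := hmem
    refine ⟨c, Amalgam.right_injective hf hg ?_⟩
    rw [← hc]
    exact Monoid.PushoutI.of_apply_eq_base (amalgamMaps f g) false c
  · rintro ⟨c, rfl⟩
    exact ⟨f c, Amalgam.left_eq_right c⟩

end AmalgamEmbedding

/-! ### The group `G_1` -/

section NoiseGroup

variable {p : ℕ} (q : ℕ) (W : NoiseWords p)

theorem map_letters_eq_one {α M : Type*} [Group M] (z : Fin 2 → α) (f : FreeGroup α →* M)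
    (h : ∀ j, f (FreeGroup.of (z j)) = 1) (w : FreeGroup (Fin 2)) :
    f (FreeGroup.map z w) = 1 := by
  have : f.comp (FreeGroup.map z) = 1 := FreeGroup.ext_hom _ _ fun j => by simpa using h j
  exact DFunLike.congr_fun this w

/-- The function on generators with value `α` at `a₁`, `τ` at `t`, and `1` elsewhere. -/
def weight {M : Type*} [CommGroup M] (α τ : M) : Gen p → M
  | Gen.a i => if i = 0 then α else 1
  | Gen.t => τ
  | _ => 1

/-- Noise letters have weight `1`, so a short noise contributes `τ` and a long one nothing. The two
sides of each relation thus have equal exponents of `a₁` and of `t`. -/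
theorem lift_weight_relator {M : Type*} [CommGroup M] (α τ : M) :
    ∀ r ∈ relators q W, FreeGroup.lift (weight α τ) r = 1 := by
  set f : FreeGroup (Gen p) →* M := FreeGroup.lift (weight α τ) with hf
  have hy : ∀ w, f (FreeGroup.map Gen.y w) = 1 :=
    map_letters_eq_one Gen.y f fun j => by simp [hf, weight]
  have hb : ∀ i w, f (FreeGroup.map (bLetter i) w) = 1 := fun i =>
    map_letters_eq_one (bLetter i) f fun j => by
      unfold bLetter
      split_ifs <;> simp [hf, weight]
  have hnext : ∀ i : Fin (p + 1), f (bNext i) = 1 := fun i => by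
    unfold bNext
    split_ifs <;> simp [hf, weight]
  have heps : ∀ i : ℕ, f (if i + 1 = q then FreeGroup.of (Gen.a 1) else 1) = 1 := fun i => by
    split_ifs <;> simp [hf, weight]
  have hof : ∀ s, f (FreeGroup.of s) = weight α τ s := fun s => by simp [hf]
  have hconj : ∀ u s v, f (conjRelator u s v) = f s * (f v)⁻¹ := fun u s v => by
    simp [conjRelator]
  clear_value f
  rintro r (((((⟨i, rfl⟩ | ⟨i, rfl⟩) | ⟨i, rfl⟩) | ⟨i, rfl⟩) | ⟨i, rfl⟩) | ⟨i, rfl⟩)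
  · simp only [rel1, hconj, map_mul, heps]
    simp [longNoise, hb, hnext, hof]
  all_goals simp [rel2, rel3, rel3', rel4, rel4', hconj, shortNoise, longNoise, hy, hb, hof, weight]

/-- The homomorphism from the group to a commutative group that sends `a₁` to `α`, `t` to `τ` and
all other generators to `1`. -/
def weightHom {M : Type*} [CommGroup M] (α τ : M) : NoiseGroup q W →* M :=
  PresentedGroup.toGroup (lift_weight_relator q W α τ)

theorem weightHom_gen {M : Type*} [CommGroup M] (α τ : M) (s : Gen p) :
    weightHom q W α τ (gen q W s) = weight α τ s :=
  PresentedGroup.toGroup.of _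

theorem infinite_noiseSubgroup : Infinite (noiseSubgroup q W) := by
  have ht : gen q W Gen.t ∈ noiseSubgroup q W := Subgroup.subset_closure (by simp)
  refine Infinite.of_injective
    (fun n : ℕ => (⟨gen q W Gen.t ^ n, Subgroup.pow_mem _ ht n⟩ : noiseSubgroup q W))
    fun m n h => ?_
  -- This weight counts the exponent of `t`, so the powers of `t` are distinct.
  have := congrArg (fun g => weightHom q W (1 : Multiplicative ℤ) (Multiplicative.ofAdd 1) g.1) h
  simpa [weightHom_gen, weight, ← ofAdd_nsmul] using this

theorem injective_rightCosetOf_noiseSubgroup : Function.Injective fun i : ℕ =>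
    rightCosetOf (noiseSubgroup q W) (gen q W (Gen.a 0) ^ i) := by
  intro m n h
  -- The exponent of `a₁` vanishes on the subgroup, so no nontrivial power of `a₁` lies in it.
  have hle : noiseSubgroup q W ≤
      (weightHom q W (Multiplicative.ofAdd (1 : ℤ)) 1).ker := by
    refine (Subgroup.closure_le _).2 ?_
    rintro x (rfl | rfl | rfl) <;> simp [MonoidHom.mem_ker, weightHom_gen, weight]
  have := hle (rightCosetOf_eq_iff.1 h)
  simpa [MonoidHom.mem_ker, weightHom_gen, weight, ← ofAdd_nsmul, mul_inv_eq_one] using this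

theorem conj_gen_eq {u s : Gen p} {v : FreeGroup (Gen p)}
    (h : conjRelator (FreeGroup.of u) (FreeGroup.of s) v ∈ relators q W) :
    (gen q W u)⁻¹ * gen q W s * gen q W u = PresentedGroup.mk (relators q W) v := by
  have := PresentedGroup.one_of_mem h
  simp only [conjRelator, map_mul, map_inv, mul_inv_eq_one] at this
  exact this

theorem mk_map_y_mem (w : FreeGroup (Fin 2)) :
    PresentedGroup.mk (relators q W) (FreeGroup.map Gen.y w) ∈ noiseSubgroup q W := by
  induction w using FreeGroup.induction_on with
  | C1 => simp
  | of j =>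
    rw [FreeGroup.map.of]
    fin_cases j
    · exact Subgroup.subset_closure (Or.inr (Or.inl rfl))
    · exact Subgroup.subset_closure (Or.inr (Or.inr rfl))
  | inv_of j h => rw [map_inv, map_inv]; exact Subgroup.inv_mem _ h
  | mul v w hv hw => rw [map_mul, map_mul]; exact Subgroup.mul_mem _ hv hw

/-- The relators of `a_i` carry noise in the `y` letters only, so the conjugates of the three
generators are again words in `t, y₁, y₂`. -/
theorem conjBy_noiseSubgroup_le (i : Fin 2) :
    conjBy (noiseSubgroup q W) (gen q W (Gen.a i)) ≤ noiseSubgroup q W := by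
  have ht : PresentedGroup.mk (relators q W) (FreeGroup.of Gen.t) ∈ noiseSubgroup q W :=
    Subgroup.subset_closure (Or.inl rfl)
  have hy : ∀ j, (gen q W (Gen.a i))⁻¹ * gen q W (Gen.y j) * gen q W (Gen.a i) ∈
      noiseSubgroup q W := fun j => by
    rw [conj_gen_eq q W (v := longNoise Gen.y (W.n4' i j)) (Or.inr ⟨(i, j), rfl⟩)]
    simp only [longNoise, map_mul, map_inv]
    exact mul_mem (mul_mem (mul_mem (mul_mem (mk_map_y_mem q W _) (inv_mem ht))
      (mk_map_y_mem q W _)) ht) (mk_map_y_mem q W _)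
  refine Subgroup.map_le_iff_le_comap.2 ((Subgroup.closure_le _).2 ?_)
  rintro x (rfl | rfl | rfl)
  · have := conj_gen_eq q W (u := Gen.a i) (s := Gen.t) (v := shortNoise Gen.y (W.n4 i))
      (Or.inl (Or.inr ⟨i, rfl⟩))
    simp only [SetLike.mem_coe, Subgroup.mem_comap, MulEquiv.coe_toMonoidHom, MulAut.conj_apply,
      inv_inv, this, shortNoise, map_mul]
    exact mul_mem (mul_mem (mk_map_y_mem q W _) ht) (mk_map_y_mem q W _)
  · simpa using hy 0
  · simpa using hy 1

theorem hasInfiniteHeight_noiseSubgroup : HasInfiniteHeight (noiseSubgroup q W) :=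
  hasInfiniteHeight_of_antitone (infinite_noiseSubgroup q W) _
    (antitone_conjBy_pow (conjBy_noiseSubgroup_le q W 0))
    (injective_rightCosetOf_noiseSubgroup q W)

end NoiseGroup

/-! ### The iterated amalgams `G_k` -/

section Iterate

variable {Γ : Type} [Group Γ]

theorem PairOver.hasInfiniteHeight_extend (P : PairOver Γ) (hP : Infinite P.F) {m : ℕ}
    (hm : 0 < m) (φ : P.F →* MulAut (FreeGroup (Fin m))) :
    HasInfiniteHeight (P.extend m φ).F := by
  have : Nonempty (Fin m) := ⟨⟨0, hm⟩⟩
  have h := (hasInfiniteHeight_range_inl φ).map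
    (Amalgam.left (SemidirectProduct.inr : P.F →* FreeGroup (Fin m) ⋊[φ] P.F) P.F.subtype)
    (Amalgam.left_injective SemidirectProduct.inr_injective P.F.subtype_injective)
  rw [MonoidHom.map_range] at h
  exact h

/-- Of the previous pair's infinite height, the inductive step needs only that its subgroup, the new
acting group, is infinite. -/
theorem IsIterate.injective_and_hasInfiniteHeight {F : Subgroup Γ} (hF : HasInfiniteHeight F)
    {m₁ k m : ℕ} {P : PairOver Γ} (hP : IsIterate (PairOver.base F) m₁ k m P) :
    Function.Injective P.ofBase ∧ HasInfiniteHeight P.F := by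
  induction hP with
  | base => exact ⟨Function.injective_id, hF⟩
  | @step k m Q hQ m' hm φ ih =>
    exact ⟨(Amalgam.right_injective SemidirectProduct.inr_injective
      Q.F.subtype_injective).comp ih.1,
      Q.hasInfiniteHeight_extend ih.2.1 (Nat.zero_lt_of_lt hm) φ⟩

end Iterate

theorem mainTheorem9 (p q : ℕ) (hq : 0 < q) (hqp : q < p) (W : NoiseWords p) (k m : ℕ)
    (P : PairOver (NoiseGroup q W))
    (hP : IsIterate (PairOver.base (noiseSubgroup q W)) 3 k m P) :
    -- the free subgroup `F_{m_k}` of `G_k`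
    HasInfiniteHeight P.F ∧
    -- the subgroup `H` of `H *_F G_k`, where `F = F_{m_k}` is embedded in the group `H`
    (∀ (H : Type) [Group H] (j : P.F →* H), Function.Injective j →
      HasInfiniteHeight (Amalgam.left j P.F.subtype).range) ∧
    -- the conjugates of `⟨t, y₁, y₂⟩` by the powers of `a₁`, in `G_k`
    HasInfiniteHeight ((noiseSubgroup q W).map P.ofBase) ∧
    Antitone (fun i : ℕ =>
      conjBy ((noiseSubgroup q W).map P.ofBase) (P.ofBase (gen q W (Gen.a 0)) ^ i)) ∧
    (∀ i : ℕ, Infinite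
      (conjBy ((noiseSubgroup q W).map P.ofBase) (P.ofBase (gen q W (Gen.a 0)) ^ i))) ∧
    Function.Injective (fun i : ℕ =>
      rightCosetOf ((noiseSubgroup q W).map P.ofBase) (P.ofBase (gen q W (Gen.a 0)) ^ i)) := by
  obtain ⟨hinj, hheight⟩ :=
    hP.injective_and_hasInfiniteHeight (hasInfiniteHeight_noiseSubgroup q W)
  have hmap := (hasInfiniteHeight_noiseSubgroup q W).map P.ofBase hinj
  refine ⟨hheight, fun H _ j hj => ?_, hmap, antitone_conjBy_pow ?_,
    fun i => infinite_conjBy hmap.1 _, fun m n h => ?_⟩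
  · refine hheight.of_comap (Amalgam.right j P.F.subtype)
      (Amalgam.right_injective hj P.F.subtype_injective) fun x => ?_
    rw [Amalgam.right_mem_range_left hj P.F.subtype_injective, Subgroup.range_subtype]
  · rw [conjBy_map]
    exact Subgroup.map_mono (conjBy_noiseSubgroup_le q W 0)
  · refine injective_rightCosetOf_noiseSubgroup q W ?_
    simp only [rightCosetOf_eq_iff, ← map_pow, ← map_inv, ← map_mul] at h ⊢
    exact (Subgroup.mem_map_iff_mem hinj).1 h
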